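/- All logarithms are to base $2$. A finite set of points in the plane is in general position if no three of its points are collinear. A geometric graph is a simple graph $G=(V,E)$ whose vertex set $V$ is a finite set of points in the plane and whose edges are represented by the straight-line segments connecting their endpoints; the segments determined by $V$ are those connecting two distinct points of $V$, that is, the edges of the complete geometric graph on $V$. Two segments are called avoiding if the supporting line of neither of them meets the other (closed) segment. (i) There exists an absolute constant $C>0$ such that, for every $n\ge 2$, any set $V$ of $n$ points in general position in the plane determines at least $n/2^{C\sqrt{\log n}}$ pairwise avoiding segments. (ii) There exists an absolute constant $c>0$ such that, for every $n\ge 2$ and every real $\varepsilon>(\log n)^{-2/3}$, any geometric graph with $n$ vertices in general position in the plane and at least $n^{2-\varepsilon}$ edges has at least $n^{1-c\sqrt{\varepsilon}}$ pairwise avoiding edges. -/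

import Mathlib

/-- The Euclidean plane. -/
abbrev Plane : Type := EuclideanSpace ℝ (Fin 2)

/-- A finite set of points of the plane is in general position if no three of its points are
collinear. -/
def InGeneralPosition (V : Finset Plane) : Prop :=
  ∀ p ∈ V, ∀ q ∈ V, ∀ r ∈ V, p ≠ q → p ≠ r → q ≠ r → ¬ Collinear ℝ ({p, q, r} : Set Plane)

/-- The set of the endpoints of an (abstract) edge `e` on the vertex set `V`, as a set of points of
the plane: for `e = s(p, q)` it is `{p, q}`. -/
def edgeEndpoints {V : Finset Plane} (e : Sym2 V) : Set Plane :=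
  {p : Plane | ∃ v ∈ e, (v : Plane) = p}

/-- The closed straight-line segment that represents the edge `e`. -/
def edgeSegment {V : Finset Plane} (e : Sym2 V) : Set Plane :=
  convexHull ℝ (edgeEndpoints e)

/-- The supporting line of the segment that represents the edge `e`. -/
def edgeLine {V : Finset Plane} (e : Sym2 V) : Set Plane :=
  (affineSpan ℝ (edgeEndpoints e) : Set Plane)

/-- Two edges are avoiding if neither closed segment is met by the supporting line of the other. -/
def AvoidingEdges {V : Finset Plane} (e f : Sym2 V) : Prop :=
  Disjoint (edgeSegment e) (edgeLine f) ∧ Disjoint (edgeSegment f) (edgeLine e)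

/-- The (straight-line) geometric graph `G` on the point set `V` has at least `x` pairwise avoiding
edges. -/
def HasPairwiseAvoidingEdges {V : Finset Plane} (G : SimpleGraph V) (x : ℝ) : Prop :=
  ∃ F : Finset (Sym2 V), (F : Set (Sym2 V)) ⊆ G.edgeSet ∧
    (F : Set (Sym2 V)).Pairwise AvoidingEdges ∧ x ≤ (F.card : ℝ)

/-! Both parts follow from one bound: e > 0 edges on n points in general position include at least
(e/n²)^12 · n/2^36 pairwise avoiding ones. For the complete graph this is linear in n.

Shear the plane so that abscissas are distinct; some vertical line then crosses many edges
(`exists_dense_cut`) and separates the points into A and B. A crossing edge ab has two levels, the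
numbers of points of A and of B under its line, and these determine it. Suppose two edges have the
same difference of levels and are not avoiding. Rotating one of the lines about an endpoint to the
other's level then shows that an edge is unstable: the level on the endpoint's own side changes, in
the direction of rotation, at least as much as the level on the opposite side. So stable edges with
a common difference are pairwise avoiding (`SeparatedBy.liesBelow`).

Unstable edges are few when few lines spanned by one side split the other. As the line rotates about
a, its level on A is an increasing plus a decreasing function of its level on B, and a rising sun
argument (`card_rising_le`) bounds the unstable edges at a by the number of c in A for which ac
splits B (`SeparatedBy.card_unstable_le`).

To make splitting rare, A and B are each cut into at most 4^m cells of which a line splits at most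
3^m (`GenericCoords.exists_partition`). Averaging over pairs of cells gives one where edges outweigh
splittings, and the pigeonhole principle picks a difference of levels. -/

open Finset

/-! ### Ranks in a finite set -/

/-- The number of elements of `S` on which `τ` is smaller than at `v`. -/
noncomputable def finRank {α : Type*} (S : Finset α) (τ : α → ℝ) (v : α) : ℕ :=
  #{u ∈ S | τ u < τ v}

theorem finRank_lt_card {α : Type*} {S : Finset α} (τ : α → ℝ) {v : α} (hv : v ∈ S) :
    finRank S τ v < #S :=
  card_lt_card (filter_ssubset.2 ⟨v, hv, lt_irrefl _⟩)

theorem finRank_mono {α : Type*} (S : Finset α) (τ : α → ℝ) {u v : α} (h : τ u ≤ τ v) :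
    finRank S τ u ≤ finRank S τ v :=
  card_le_card (monotone_filter_right _ fun _ _ hw => lt_of_lt_of_le hw h)

theorem finRank_lt_iff {α : Type*} {S : Finset α} (τ : α → ℝ) {u v : α} (hu : u ∈ S) :
    finRank S τ u < finRank S τ v ↔ τ u < τ v := by
  constructor
  · intro h
    by_contra! h'
    exact absurd (finRank_mono S τ h') (by omega)
  · intro h
    refine card_lt_card (ssubset_of_subset_not_subset
      (monotone_filter_right _ fun _ _ hw => lt_trans hw h) fun hs => ?_)
    have := hs (mem_filter.2 ⟨hu, h⟩)
    exact lt_irrefl _ (mem_filter.1 this).2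

theorem finRank_injOn {α : Type*} {S : Finset α} {τ : α → ℝ} (hτ : Set.InjOn τ S) :
    Set.InjOn (finRank S τ) S := by
  intro u hu v hv h
  refine hτ hu hv (le_antisymm ?_ ?_)
  · by_contra! h'
    have := (finRank_lt_iff τ hv).2 h'
    omega
  · by_contra! h'
    have := (finRank_lt_iff τ hu).2 h'
    omega

theorem image_finRank {α : Type*} {S : Finset α} {τ : α → ℝ} (hτ : Set.InjOn τ S) :
    S.image (finRank S τ) = range #S := by
  refine eq_of_subset_of_card_le ?_ ?_
  · intro j hj
    obtain ⟨v, hv, rfl⟩ := mem_image.1 hj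
    exact mem_range.2 (finRank_lt_card τ hv)
  · rw [card_image_of_injOn (finRank_injOn hτ), card_range]

theorem exists_finRank_eq {α : Type*} {S : Finset α} {τ : α → ℝ} (hτ : Set.InjOn τ S) {j : ℕ}
    (hj : j < #S) : ∃ v ∈ S, finRank S τ v = j := by
  have : j ∈ S.image (finRank S τ) := by rw [image_finRank hτ]; exact mem_range.2 hj
  simpa using this

/-! ### Rising sun lemma -/

/-- A discrete form of the rising sun lemma: for a sum of a nondecreasing and a nonincreasing
sequence, the number of indices that are reached from an earlier one with average slope at
least one is at most the total increase of the nondecreasing part. -/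
theorem card_rising_le (R L : ℕ → ℤ) (n : ℕ) (hR : ∀ j, j + 1 < n → R j ≤ R (j + 1))
    (hL : ∀ j, j + 1 < n → L (j + 1) ≤ L j) :
    (#{j ∈ range n | ∃ i < j, R i + L i + (j - i) ≤ R j + L j} : ℤ) ≤ R (n - 1) - R 0 := by
  classical
  -- With g j = R j + L j - j, the index j is counted when g i ≤ g j for some i < j. The invariant
  -- says that the count plus the height of g over its running minimum is at most the increase of R.
  -- A counted step raises g by at most the increment of R minus one, which pays for the new index;
  -- at an uncounted step g reaches a new strict minimum.
  have key : ∀ j, j < n → ∀ i ≤ j,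
      (#{j ∈ range (j + 1) | ∃ i < j, R i + L i + (j - i) ≤ R j + L j} : ℤ)
        + (R j + L j - j) - (R i + L i - i) ≤ R j - R 0 := by
    intro j
    induction j with
    | zero =>
      intro _ i hi
      obtain rfl : i = 0 := by omega
      simp
    | succ j ih =>
      intro hj i hi
      have ih := ih (by omega)
      have h1 := hR j hj
      have h2 := hL j hj
      rw [range_add_one, filter_insert]
      split_ifs with hb
      · rw [card_insert_of_notMem (by simp)]
        obtain ⟨k, hk, hk'⟩ := hb
        have ihk := ih k (by omega)
        push_cast at hk' ⊢
        rcases Nat.lt_or_ge i (j + 1) with h | h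
        · have ihi := ih i (by omega)
          linarith
        · obtain rfl : i = j + 1 := by omega
          push_cast
          linarith
      · push Not at hb
        have ihj := ih j le_rfl
        push_cast at hb ⊢
        rcases Nat.lt_or_ge i (j + 1) with h | h
        · have := hb i h
          linarith
        · obtain rfl : i = j + 1 := by omega
          push_cast
          linarith
  rcases Nat.eq_zero_or_pos n with rfl | hn
  · simp
  · have := key (n - 1) (by omega) (n - 1) le_rfl
    rw [Nat.sub_add_cancel hn] at this
    linarith

theorem card_rising_le' (R L : ℕ → ℤ) (n : ℕ) (hR : ∀ j, j + 1 < n → R j ≤ R (j + 1))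
    (hL : ∀ j, j + 1 < n → L (j + 1) ≤ L j) :
    (#{j ∈ range n | ∃ k < n, j < k ∧ R j + L j + (k - j) ≤ R k + L k} : ℤ)
      ≤ R (n - 1) - R 0 := by
  classical
  -- Reversing the order and negating both sequences preserves the hypotheses and exchanges earlier
  -- with later indices.
  have h := card_rising_le (fun j => - R (n - 1 - j)) (fun j => - L (n - 1 - j)) n
    (fun j hj => by
      have := hR (n - 1 - (j + 1)) (by omega)
      rw [show n - 1 - (j + 1) + 1 = n - 1 - j by omega] at this
      simpa using this)
    (fun j hj => by
      have := hL (n - 1 - (j + 1)) (by omega)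
      rw [show n - 1 - (j + 1) + 1 = n - 1 - j by omega] at this
      simpa using this)
  simp only [Nat.sub_zero, Nat.sub_self] at h
  refine le_trans (Nat.cast_le.2 (card_le_card_of_injOn (fun j => n - 1 - j) ?_ ?_)) (h.trans ?_)
  · intro j hj
    simp only [coe_filter, mem_range, Set.mem_ofPred_eq] at hj ⊢
    obtain ⟨hj, k, hk, hjk, h'⟩ := hj
    refine ⟨by omega, n - 1 - k, by omega, ?_⟩
    rw [show n - 1 - (n - 1 - k) = k by omega, show n - 1 - (n - 1 - j) = j by omega]
    have e1 : ((n - 1 - k : ℕ) : ℤ) = n - 1 - k := by omega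
    have e2 : ((n - 1 - j : ℕ) : ℤ) = n - 1 - j := by omega
    rw [e1, e2]
    linarith
  · intro i hi j hj hij
    simp only [coe_filter, mem_range, Set.mem_ofPred_eq] at hi hj hij
    omega
  · linarith

/-! ### Lines, levels and separated sets -/

/-- The slope of the line through `p` and `q`, in the coordinates `X`, `Y`. -/
noncomputable def slopeOf {α : Type*} (X Y : α → ℝ) (p q : α) : ℝ := (Y q - Y p) / (X q - X p)

/-- The height over `x` of the line through `p` and `q`. -/
noncomputable def lineAt {α : Type*} (X Y : α → ℝ) (p q : α) (x : ℝ) : ℝ :=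
  Y p + slopeOf X Y p q * (x - X p)

/-- The number of points of `S` strictly below the line through `p` and `q`. -/
noncomputable def level {α : Type*} (X Y : α → ℝ) (S : Finset α) (p q : α) : ℕ :=
  #{c ∈ S | Y c < lineAt X Y p q (X c)}

/-- The graph of `f` has points of `S` strictly on both of its sides. -/
def Splits {α : Type*} (X Y : α → ℝ) (S : Finset α) (f : ℝ → ℝ) : Prop :=
  (∃ d ∈ S, Y d < f (X d)) ∧ ∃ d ∈ S, f (X d) < Y d

/-- No two points have the same abscissa, and no three points are collinear. -/
structure GenericCoords {α : Type*} (X Y : α → ℝ) : Prop where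
  inj : Function.Injective X
  off_line : ∀ p q r, p ≠ q → p ≠ r → q ≠ r → Y r ≠ lineAt X Y p q (X r)

/-- Up to the sign of `σ`, all points of `A` are to the left of all points of `B`. -/
def SeparatedBy {α : Type*} (X : α → ℝ) (σ : ℝ) (A B : Finset α) : Prop :=
  ∀ a ∈ A, ∀ b ∈ B, 0 < σ * (X b - X a)

section Lines

variable {α : Type*} {X Y : α → ℝ} {σ : ℝ} {A B : Finset α}

theorem SeparatedBy.symm (h : SeparatedBy X σ A B) : SeparatedBy X (-σ) B A := fun b hb a ha => by
  have := h a ha b hb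
  linarith

theorem SeparatedBy.ne (h : SeparatedBy X σ A B) {a b : α} (ha : a ∈ A) (hb : b ∈ B) :
    X a ≠ X b := fun e => by
  have := h a ha b hb
  simp [e] at this

theorem lineAt_left (p q : α) : lineAt X Y p q (X p) = Y p := by simp [lineAt]

theorem lineAt_right {p q : α} (h : X p ≠ X q) : lineAt X Y p q (X q) = Y q := by
  have : X q - X p ≠ 0 := sub_ne_zero.2 h.symm
  rw [lineAt, slopeOf, div_mul_cancel₀ _ this]
  ring

theorem lineAt_comm {p q : α} (h : X p ≠ X q) : lineAt X Y p q = lineAt X Y q p := by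
  have h1 : X q - X p ≠ 0 := sub_ne_zero.2 h.symm
  have h2 : X p - X q ≠ 0 := sub_ne_zero.2 h
  funext x
  rw [lineAt, lineAt, slopeOf, slopeOf]
  field_simp
  ring

theorem level_comm {S : Finset α} {p q : α} (h : X p ≠ X q) :
    level X Y S p q = level X Y S q p := by
  rw [level, level, lineAt_comm h]

theorem lineAt_eq (p q : α) (x : ℝ) :
    lineAt X Y p q x = slopeOf X Y p q * x + (Y p - slopeOf X Y p q * X p) := by
  rw [lineAt]; ring

/-- The factor `σ` lets one argument serve both directions: rotation about a, seen from the side of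
c, is ordered by `σ * slope`. -/
theorem lt_lineAt_iff {a b c : α} (hc : 0 < σ * (X c - X a)) :
    Y c < lineAt X Y a b (X c) ↔ σ * slopeOf X Y a c < σ * slopeOf X Y a b := by
  have hne : X a ≠ X c := fun e => by simp [e] at hc
  have e : Y c = Y a + slopeOf X Y a c * (X c - X a) := (lineAt_right hne).symm
  conv_lhs => rw [e, lineAt]
  rcases mul_pos_iff.1 hc with ⟨h1, h2⟩ | ⟨h1, h2⟩
  · rw [add_lt_add_iff_left, mul_lt_mul_iff_left₀ h2, mul_lt_mul_iff_right₀ h1]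
  · rw [add_lt_add_iff_left, mul_lt_mul_right_of_neg h2, mul_lt_mul_left_of_neg h1]

theorem lt_lineAt_iff' {a b c : α} (hc : 0 < σ * (X a - X c)) :
    Y c < lineAt X Y a b (X c) ↔ σ * slopeOf X Y a b < σ * slopeOf X Y a c := by
  rw [lt_lineAt_iff (σ := -σ) (by linarith)]
  constructor <;> intro h <;> linarith

theorem lineAt_lt_iff {a b c : α} (hc : 0 < σ * (X c - X a)) :
    lineAt X Y a b (X c) < Y c ↔ σ * slopeOf X Y a b < σ * slopeOf X Y a c := by
  have hne : X a ≠ X c := fun e => by simp [e] at hc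
  have e : Y c = Y a + slopeOf X Y a c * (X c - X a) := (lineAt_right hne).symm
  conv_lhs => rw [e, lineAt]
  rcases mul_pos_iff.1 hc with ⟨h1, h2⟩ | ⟨h1, h2⟩
  · rw [add_lt_add_iff_left, mul_lt_mul_iff_left₀ h2, mul_lt_mul_iff_right₀ h1]
  · rw [add_lt_add_iff_left, mul_lt_mul_right_of_neg h2, mul_lt_mul_left_of_neg h1]

theorem SeparatedBy.level_eq_finRank (h : SeparatedBy X σ A B) {a : α} (ha : a ∈ A) (b : α) :
    level X Y B a b = finRank B (fun c => σ * slopeOf X Y a c) b := by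
  rw [level, finRank]
  exact congrArg card (filter_congr fun c hc => lt_lineAt_iff (h a ha c hc))

theorem SeparatedBy.slope_injOn (h : SeparatedBy X σ A B) (hg : GenericCoords X Y) {a : α}
    (ha : a ∈ A) : Set.InjOn (fun c => σ * slopeOf X Y a c) B := by
  intro b hb c hc e
  by_contra hbc
  have hab := h.ne ha hb
  have hac := h.ne ha hc
  refine hg.off_line a b c (fun e => hab (e ▸ rfl)) (fun e => hac (e ▸ rfl)) hbc ?_
  refine le_antisymm ?_ ?_
  · by_contra! h'
    exact ne_of_lt ((lineAt_lt_iff (h a ha c hc)).1 h') e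
  · by_contra! h'
    exact ne_of_lt ((lt_lineAt_iff (h a ha c hc)).1 h') e.symm

theorem SeparatedBy.level_lt_card (h : SeparatedBy X σ A B) {a b : α} (ha : a ∈ A) (hb : b ∈ B) :
    level X Y B a b < #B := by
  rw [h.level_eq_finRank ha]
  exact finRank_lt_card _ hb

theorem SeparatedBy.exists_level_eq (h : SeparatedBy X σ A B) (hg : GenericCoords X Y) {a : α}
    (ha : a ∈ A) {j : ℕ} (hj : j < #B) : ∃ b ∈ B, level X Y B a b = j := by
  simp_rw [h.level_eq_finRank ha]
  exact exists_finRank_eq (h.slope_injOn hg ha) hj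

theorem SeparatedBy.level_injOn (h : SeparatedBy X σ A B) (hg : GenericCoords X Y) {a : α}
    (ha : a ∈ A) : Set.InjOn (level X Y B a) B := by
  intro b hb c hc e
  rw [h.level_eq_finRank ha, h.level_eq_finRank ha] at e
  exact finRank_injOn (h.slope_injOn hg ha) hb hc e

/-- The affine function changes sign between u and v, both on the same side of B, so it has no zero
on the side of B. -/
theorem affine_pos_or_neg {m k u v σ : ℝ} {B : Finset α} (hu : ∀ w ∈ B, 0 < σ * (X w - u))
    (hv : ∀ w ∈ B, 0 < σ * (X w - v)) (h1 : m * u + k ≤ 0) (h2 : 0 < m * v + k) :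
    (∀ w ∈ B, 0 < m * X w + k) ∨ ∀ w ∈ B, m * X w + k < 0 := by
  have key : 0 < m * (v - u) := by linarith
  rcases lt_or_ge 0 (m * σ) with hm | hm
  · left
    intro w hw
    have h := hv w hw
    have : 0 < m * (X w - v) := by
      rcases mul_pos_iff.1 hm with ⟨a, b⟩ | ⟨a, b⟩
      · exact mul_pos a (pos_of_mul_pos_right h b.le)
      · exact mul_pos_of_neg_of_neg a (by by_contra! h'; nlinarith)
    linarith
  · right
    intro w hw
    have h := hu w hw
    have : m * (X w - u) < 0 := by
      have hm0 : m ≠ 0 := fun e => by simp [e] at key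
      have hs0 : σ ≠ 0 := fun e => by simp [e] at h
      have hm' : m * σ < 0 := lt_of_le_of_ne hm (mul_ne_zero hm0 hs0)
      rcases mul_neg_iff.1 hm' with ⟨a, b⟩ | ⟨a, b⟩
      · exact mul_neg_of_pos_of_neg a (by by_contra! h'; nlinarith)
      · exact mul_neg_of_neg_of_pos a (pos_of_mul_pos_right h b.le)
    linarith

/-- Two lines with the same number of points of `B` below them, each through a point of `B`, are
ordered in the same way everywhere on the side of `A`. -/
theorem SeparatedBy.lineAt_le (h : SeparatedBy X σ A B) {a a' b b' : α} (ha : a ∈ A)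
    (ha' : a' ∈ A) (hb : b ∈ B) (hb' : b' ∈ B)
    (hlev : level X Y B a b = level X Y B a' b') {u : α} (hu : u ∈ A)
    (hle : lineAt X Y a b (X u) ≤ lineAt X Y a' b' (X u)) {c : α} (hc : c ∈ A) :
    lineAt X Y a b (X c) ≤ lineAt X Y a' b' (X c) := by
  -- Otherwise the lines cross on the side of A, so one is strictly below the other over all of B.
  -- The lower one passes through a point of B, which counts only for the upper one, so the levels
  -- on B differ.
  by_contra! hlt
  have aux : ∀ {p q p' q' : α}, p ∈ A → q ∈ B →
      (∀ w ∈ B, lineAt X Y p q (X w) < lineAt X Y p' q' (X w)) →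
      level X Y B p q < level X Y B p' q' := by
    intro p q p' q' hp hq hw
    refine card_lt_card (ssubset_of_subset_not_subset (fun w hwB => ?_) fun hs => ?_)
    · rw [mem_filter] at hwB ⊢
      exact ⟨hwB.1, hwB.2.trans (hw w hwB.1)⟩
    · have e := lineAt_right (Y := Y) (h.ne hp hq)
      have := hs (mem_filter.2 ⟨hq, e ▸ hw q hq⟩)
      rw [mem_filter, e] at this
      exact lt_irrefl _ this.2
  simp only [lineAt_eq] at hle hlt
  rcases affine_pos_or_neg (m := slopeOf X Y a b - slopeOf X Y a' b')
    (k := (Y a - slopeOf X Y a b * X a) - (Y a' - slopeOf X Y a' b' * X a'))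
    (fun w hw => h u hu w hw) (fun w hw => h c hc w hw) (by linarith) (by linarith) with hw | hw
  · have := aux (p := a') (q := b') (p' := a) (q' := b) ha' hb' fun w hwB => by
      have := hw w hwB
      simp only [lineAt_eq]
      linarith
    omega
  · have := aux (p := a) (q := b) (p' := a') (q' := b') ha hb fun w hwB => by
      have := hw w hwB
      simp only [lineAt_eq]
      linarith
    omega

theorem SeparatedBy.level_le_level (h : SeparatedBy X σ A B) {a a' b b' : α} (ha : a ∈ A)
    (ha' : a' ∈ A) (hb : b ∈ B) (hb' : b' ∈ B)
    (hlev : level X Y B a b = level X Y B a' b') {u : α} (hu : u ∈ A)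
    (hle : lineAt X Y a b (X u) ≤ lineAt X Y a' b' (X u)) :
    level X Y A a b ≤ level X Y A a' b' :=
  card_le_card fun c hc => by
    rw [mem_filter] at hc ⊢
    exact ⟨hc.1, hc.2.trans_le (h.lineAt_le ha ha' hb hb' hlev hu hle hc.1)⟩

/-- Strictness comes from a itself: it is on its own line but, by genericity, strictly below the
other. -/
theorem SeparatedBy.level_lt_level (h : SeparatedBy X σ A B) (hg : GenericCoords X Y)
    {a a' b b' : α} (ha : a ∈ A)
    (ha' : a' ∈ A) (hb : b ∈ B) (hb' : b' ∈ B) (hne : a ≠ a')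
    (hlev : level X Y B a b = level X Y B a' b') {u : α} (hu : u ∈ A)
    (hle : lineAt X Y a b (X u) ≤ lineAt X Y a' b' (X u)) :
    level X Y A a b < level X Y A a' b' := by
  refine card_lt_card (ssubset_of_subset_not_subset (fun c hc => ?_) fun hs => ?_)
  · rw [mem_filter] at hc ⊢
    exact ⟨hc.1, hc.2.trans_le (h.lineAt_le ha ha' hb hb' hlev hu hle hc.1)⟩
  · have h1 := h.lineAt_le ha ha' hb hb' hlev hu hle ha
    rw [lineAt_left] at h1
    have hb'a : b' ≠ a := fun e => h.ne ha hb' (e ▸ rfl)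
    have ha'b' : a' ≠ b' := fun e => h.ne ha' hb' (e ▸ rfl)
    have h2 := lt_of_le_of_ne h1 (hg.off_line a' b' a ha'b' hne.symm hb'a)
    have := hs (mem_filter.2 ⟨ha, h2⟩)
    rw [mem_filter, lineAt_left] at this
    exact lt_irrefl _ this.2

/-- An edge is determined by the numbers of points of `A` and of `B` below its line. -/
theorem SeparatedBy.eq_of_levels_eq (h : SeparatedBy X σ A B) (hg : GenericCoords X Y)
    {a a' b b' : α} (ha : a ∈ A) (ha' : a' ∈ A) (hb : b ∈ B) (hb' : b' ∈ B)
    (hB : level X Y B a b = level X Y B a' b') (hA : level X Y A a b = level X Y A a' b') :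
    a = a' ∧ b = b' := by
  have haa : a = a' := by
    by_contra hne
    rcases le_total (lineAt X Y a b (X a)) (lineAt X Y a' b' (X a)) with hle | hle
    · have := h.level_lt_level hg ha ha' hb hb' hne hB ha hle
      omega
    · have := h.level_lt_level hg ha' ha hb' hb (Ne.symm hne) hB.symm ha hle
      omega
  subst haa
  exact ⟨rfl, h.level_injOn hg ha hb hb' hB⟩

/-- Two separated sets have a common cut with prescribed numbers of points below. -/
theorem SeparatedBy.exists_levels_eq (h : SeparatedBy X σ A B) (hg : GenericCoords X Y)
    {i j : ℕ} (hi : i < #A) (hj : j < #B) :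
    ∃ a ∈ A, ∃ b ∈ B, level X Y A a b = i ∧ level X Y B a b = j := by
  classical
  -- A discrete ham sandwich argument: each a has one partner of level j on B. The resulting edges
  -- have distinct levels on A, all less than `#A`, so every value occurs.
  choose! f hf hfl using fun a (ha : a ∈ A) => h.exists_level_eq hg ha hj
  have hinj : Set.InjOn (fun a => level X Y A a (f a)) A := fun a ha a' ha' e =>
    (h.eq_of_levels_eq hg ha ha' (hf a ha) (hf a' ha')
      ((hfl a ha).trans (hfl a' ha').symm) e).1
  have himg : A.image (fun a => level X Y A a (f a)) = range #A := by
    refine eq_of_subset_of_card_le (fun k hk => ?_) ?_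
    · obtain ⟨a, ha, rfl⟩ := mem_image.1 hk
      have := h.symm.level_lt_card (Y := Y) (hf a ha) ha
      rw [level_comm (h.ne ha (hf a ha)).symm] at this
      exact mem_range.2 this
    · rw [card_image_of_injOn hinj, card_range]
  obtain ⟨a, ha, e⟩ := mem_image.1 (himg ▸ mem_range.2 hi : i ∈ A.image _)
  exact ⟨a, ha, f a, hf a ha, e, hfl a ha⟩

end Lines

/-! ### Stable edges -/

/-- The line through `a` rotated down from the edge `ab` meets a point `b'` of `B` such that the
number of points of `A` below it has dropped at least as much as that of `B`. -/
def DropsDown {α : Type*} (X Y : α → ℝ) (A B : Finset α) (a b : α) : Prop :=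
  ∃ b' ∈ B, level X Y B a b' < level X Y B a b ∧
    level X Y A a b' + level X Y B a b ≤ level X Y A a b + level X Y B a b'

/-- The line through `a` rotated up from the edge `ab` meets a point `b'` of `B` such that the
number of points of `A` below it has grown at least as much as that of `B`. -/
def GrowsUp {α : Type*} (X Y : α → ℝ) (A B : Finset α) (a b : α) : Prop :=
  ∃ b' ∈ B, level X Y B a b < level X Y B a b' ∧
    level X Y A a b + level X Y B a b' ≤ level X Y A a b' + level X Y B a b

/-- The edges `e` and `f` are avoiding, with `f` above the line of `e` and `e` below that of `f`. -/
def LiesBelow {α : Type*} (X Y : α → ℝ) (e f : α × α) : Prop :=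
  (lineAt X Y e.1 e.2 (X f.1) < Y f.1 ∧ lineAt X Y e.1 e.2 (X f.2) < Y f.2) ∧
    Y e.1 < lineAt X Y f.1 f.2 (X e.1) ∧ Y e.2 < lineAt X Y f.1 f.2 (X e.2)

section Edges

variable {α : Type*} {X Y : α → ℝ} {σ : ℝ} {A B : Finset α}

/-- If a' were on or below the line ab, rotating a'b' about a' down to the level of ab on B would
give a line below ab on the side of A. Its level on A would be at most that of ab, so by the equal
differences A would have lost at least as many points as B. -/
theorem SeparatedBy.lt_of_not_dropsDown (h : SeparatedBy X σ A B) (hg : GenericCoords X Y)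
    {a a' b b' : α} (ha : a ∈ A) (ha' : a' ∈ A) (hb : b ∈ B)
    (hlt : level X Y B a b < level X Y B a' b')
    (hd : level X Y A a b + level X Y B a' b' = level X Y A a' b' + level X Y B a b)
    (hn : ¬ DropsDown X Y A B a' b') : lineAt X Y a b (X a') < Y a' := by
  by_contra! hle
  obtain ⟨c, hc, hcl⟩ := h.exists_level_eq hg ha' (h.level_lt_card (Y := Y) ha hb)
  have := h.level_le_level ha' ha hc hb hcl ha' (by rwa [lineAt_left])
  exact hn ⟨c, hc, by omega, by omega⟩

theorem SeparatedBy.lt_of_not_growsUp (h : SeparatedBy X σ A B) (hg : GenericCoords X Y)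
    {a a' b b' : α} (ha : a ∈ A) (ha' : a' ∈ A) (hb' : b' ∈ B)
    (hlt : level X Y B a b < level X Y B a' b')
    (hd : level X Y A a b + level X Y B a' b' = level X Y A a' b' + level X Y B a b)
    (hn : ¬ GrowsUp X Y A B a b) : Y a < lineAt X Y a' b' (X a) := by
  by_contra! hle
  obtain ⟨c, hc, hcl⟩ := h.exists_level_eq hg ha (h.level_lt_card (Y := Y) ha' hb')
  have := h.level_le_level ha' ha hb' hc hcl.symm ha (by rwa [lineAt_left])
  exact hn ⟨c, hc, by omega, by omega⟩

/-- The edge `ab` is stable when lines rotate about either of its endpoints. -/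
structure StableEdge (X Y : α → ℝ) (A B : Finset α) (a b : α) : Prop where
  not_down : ¬ DropsDown X Y A B a b
  not_up : ¬ GrowsUp X Y A B a b
  not_down' : ¬ DropsDown X Y B A b a
  not_up' : ¬ GrowsUp X Y B A b a

theorem SeparatedBy.liesBelow (h : SeparatedBy X σ A B) (hg : GenericCoords X Y)
    {a a' b b' : α} (ha : a ∈ A) (ha' : a' ∈ A) (hb : b ∈ B) (hb' : b' ∈ B)
    (hlt : level X Y B a b < level X Y B a' b')
    (hd : level X Y A a b + level X Y B a' b' = level X Y A a' b' + level X Y B a b)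
    (hs : StableEdge X Y A B a b) (hs' : StableEdge X Y A B a' b') :
    LiesBelow X Y (a, b) (a', b') := by
  have e := h.ne ha hb
  have e' := h.ne ha' hb'
  -- Equal differences make the levels on A increase as well, so the rotation lemmas also apply with
  -- A and B exchanged.
  have hlt2 : level X Y A b a < level X Y A b' a' := by
    rw [level_comm e.symm, level_comm e'.symm]; omega
  have hd2 : level X Y B b a + level X Y A b' a' = level X Y B b' a' + level X Y A b a := by
    simp only [level_comm e.symm, level_comm e'.symm]; omega
  refine ⟨⟨h.lt_of_not_dropsDown hg ha ha' hb hlt hd hs'.not_down, ?_⟩,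
    h.lt_of_not_growsUp hg ha ha' hb' hlt hd hs.not_up, ?_⟩
  · have := h.symm.lt_of_not_dropsDown hg hb hb' ha hlt2 hd2 hs'.not_down'
    rwa [lineAt_comm e.symm] at this
  · have := h.symm.lt_of_not_growsUp hg hb hb' ha' hlt2 hd2 hs.not_up'
    rwa [lineAt_comm e'.symm] at this

-- Rotate a line about a through the points of B in order of level and apply the rising sun lemma to
-- its level on A.
open Classical in
theorem SeparatedBy.card_unstable_le (h : SeparatedBy X σ A B) (hg : GenericCoords X Y)
    {a : α} (ha : a ∈ A) :
    #{b ∈ B | DropsDown X Y A B a b} ≤ #{c ∈ A | Splits X Y B (lineAt X Y a c)} ∧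
      #{b ∈ B | GrowsUp X Y A B a b} ≤ #{c ∈ A | Splits X Y B (lineAt X Y a c)} := by
  rcases B.eq_empty_or_nonempty with rfl | hB
  · simp
  have hn := hB.card_pos
  have : Nonempty α := ⟨a⟩
  choose! β hβ hβl using fun j (hj : j < #B) => h.exists_level_eq hg ha hj
  set τ : α → ℝ := fun c => σ * slopeOf X Y a c with hτ
  -- `R` counts the points of A under the line on the B-side of a, which are gained as it rotates
  -- up; `L` counts those beyond a, which are lost.
  let R : ℕ → ℕ := fun j => #{c ∈ A | 0 < σ * (X c - X a) ∧ τ c < τ (β j)}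
  let L : ℕ → ℕ := fun j => #{c ∈ A | 0 < σ * (X a - X c) ∧ τ (β j) < τ c}
  have hlev : ∀ b, level X Y A a b = #{c ∈ A | 0 < σ * (X c - X a) ∧ τ c < τ b}
      + #{c ∈ A | 0 < σ * (X a - X c) ∧ τ b < τ c} := by
    intro b
    rw [← card_union_of_disjoint (disjoint_filter.2 fun c _ h1 h2 => by linarith [h1.1, h2.1]),
      ← filter_or, level]
    refine congrArg card (filter_congr fun c _ => ?_)
    rcases lt_trichotomy (σ * (X c - X a)) 0 with h0 | h0 | h0
    · rw [lt_lineAt_iff' (σ := σ) (by linarith)]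
      simp only [not_lt.2 h0.le, false_and, false_or]
      exact ⟨fun h => ⟨by linarith, h⟩, fun h => h.2⟩
    · have h1 : ¬ 0 < σ * (X a - X c) := by linarith
      have hca : X c = X a := by
        obtain ⟨b0, hb0⟩ := hB
        have := h a ha b0 hb0
        rcases mul_eq_zero.1 h0 with e | e
        · simp [e] at this
        · linarith
      have : c = a := hg.inj hca
      subst this
      simp [lineAt_left]
    · rw [lt_lineAt_iff h0]
      simp only [h0, true_and, not_lt.2 (show σ * (X a - X c) ≤ 0 by linarith), false_and,
        or_false]
      exact Iff.rfl
  have hτl : ∀ j < #B, ∀ k < #B, j ≤ k → τ (β j) ≤ τ (β k) := by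
    intro j hj k hk hjk
    by_contra! hlt
    have := (finRank_lt_iff τ (hβ k hk)).2 hlt
    rw [← h.level_eq_finRank ha, ← h.level_eq_finRank ha, hβl j hj, hβl k hk] at this
    omega
  have hR : ∀ j, j + 1 < #B → (R j : ℤ) ≤ R (j + 1) := fun j hj =>
    Nat.cast_le.2 (card_le_card (monotone_filter_right _ fun c _ hc =>
      ⟨hc.1, hc.2.trans_le (hτl j (by omega) (j + 1) hj (by omega))⟩))
  have hL : ∀ j, j + 1 < #B → (L (j + 1) : ℤ) ≤ L j := fun j hj =>
    Nat.cast_le.2 (card_le_card (monotone_filter_right _ fun c _ hc =>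
      ⟨hc.1, (hτl j (by omega) (j + 1) hj (by omega)).trans_lt hc.2⟩))
  have hinc : (R (#B - 1) : ℤ) - R 0 ≤ #{c ∈ A | Splits X Y B (lineAt X Y a c)} := by
    have : R (#B - 1) ≤ R 0 + #{c ∈ A | Splits X Y B (lineAt X Y a c)} := by
      refine le_trans (card_le_card fun c hc => ?_) (card_union_le _ _)
      rw [mem_filter] at hc
      obtain ⟨hcA, hc0, hcτ⟩ := hc
      rw [mem_union, mem_filter, mem_filter]
      by_cases h0 : τ c < τ (β 0)
      · exact Or.inl ⟨hcA, hc0, h0⟩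
      -- A point c gained between the extreme positions has the lowest point of B, as seen from a,
      -- below the line ac and the highest one above it.
      · refine Or.inr ⟨hcA, ⟨β 0, hβ 0 hn, ?_⟩, β (#B - 1), hβ _ (by omega), ?_⟩
        · refine lt_of_le_of_ne ?_ ?_
          · by_contra! h1
            exact h0 ((lineAt_lt_iff (h a ha _ (hβ 0 hn))).1 h1)
          · refine hg.off_line a c (β 0) (fun e => by simp [e] at hc0)
              (fun e => h.ne ha (hβ 0 hn) (e ▸ rfl)) (fun e => h.ne hcA (hβ 0 hn) (e ▸ rfl))
        · exact (lineAt_lt_iff (h a ha _ (hβ _ (by omega)))).2 hcτ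
    omega
  have hβeq : ∀ b ∈ B, β (level X Y B a b) = b := fun b hb =>
    h.level_injOn hg ha (hβ _ (h.level_lt_card ha hb)) hb (hβl _ (h.level_lt_card ha hb))
  have hA : ∀ b ∈ B, (level X Y A a b : ℤ) = R (level X Y B a b) + L (level X Y B a b) := by
    intro b hb
    rw [hlev b]
    simp only [R, L, hβeq b hb]
    push_cast
    rfl
  constructor
  · have key := (card_rising_le (fun j => R j) (fun j => L j) #B hR hL).trans hinc
    refine le_trans (card_le_card_of_injOn (level X Y B a) ?_
      ((h.level_injOn hg ha).mono (coe_subset.2 (filter_subset _ _)))) (Nat.cast_le.1 key)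
    intro b hb
    simp only [coe_filter, Set.mem_ofPred_eq, mem_range] at hb ⊢
    obtain ⟨hb, b', hb', h1, h2⟩ := hb
    refine ⟨h.level_lt_card ha hb, _, h1, ?_⟩
    have := hA b hb
    have := hA b' hb'
    omega
  · have key := (card_rising_le' (fun j => R j) (fun j => L j) #B hR hL).trans hinc
    refine le_trans (card_le_card_of_injOn (level X Y B a) ?_
      ((h.level_injOn hg ha).mono (coe_subset.2 (filter_subset _ _)))) (Nat.cast_le.1 key)
    intro b hb
    simp only [coe_filter, Set.mem_ofPred_eq, mem_range] at hb ⊢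
    obtain ⟨hb, b', hb', h1, h2⟩ := hb
    refine ⟨h.level_lt_card ha hb, _, h.level_lt_card ha hb', h1, ?_⟩
    have := hA b hb
    have := hA b' hb'
    omega

open Classical in
theorem SeparatedBy.card_unstable_pairs_le (h : SeparatedBy X σ A B) (hg : GenericCoords X Y) :
    #{e ∈ A ×ˢ B | DropsDown X Y A B e.1 e.2 ∨ GrowsUp X Y A B e.1 e.2} ≤
      2 * #{e ∈ A ×ˢ A | Splits X Y B (lineAt X Y e.1 e.2)} := by
  rw [card_filter, card_filter, sum_product, sum_product, mul_sum]
  refine sum_le_sum fun a ha => ?_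
  rw [← card_filter, ← card_filter, filter_or]
  dsimp only
  have := h.card_unstable_le hg ha
  have := card_union_le {b ∈ B | DropsDown X Y A B a b} {b ∈ B | GrowsUp X Y A B a b}
  omega

open Classical in
/-- A bipartite geometric graph on separated point sets has many pairwise avoiding edges, if few
of the lines spanned by either set split the other set. -/
theorem SeparatedBy.exists_avoiding (h : SeparatedBy X σ A B) (hg : GenericCoords X Y) {s : ℕ}
    (hs : 0 < s) (hA : #A ≤ s) (hB : #B ≤ s) (E : Finset (α × α)) (hE : E ⊆ A ×ˢ B) :
    ∃ F ⊆ E, (∀ e ∈ F, ∀ f ∈ F, e ≠ f → LiesBelow X Y e f ∨ LiesBelow X Y f e) ∧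
      (#E : ℝ) - 2 * #{e ∈ A ×ˢ A | Splits X Y B (lineAt X Y e.1 e.2)}
        - 2 * #{e ∈ B ×ˢ B | Splits X Y A (lineAt X Y e.1 e.2)} ≤ 2 * s * #F := by
  set NA := #{e ∈ A ×ˢ A | Splits X Y B (lineAt X Y e.1 e.2)}
  set NB := #{e ∈ B ×ˢ B | Splits X Y A (lineAt X Y e.1 e.2)}
  set E' := E.filter fun e => StableEdge X Y A B e.1 e.2
  have hcard : #E ≤ #E' + 2 * NA + 2 * NB := by
    have h1 := h.card_unstable_pairs_le hg
    have h2 := h.symm.card_unstable_pairs_le hg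
    have h3 : #E ≤ #E' +
        #{e ∈ A ×ˢ B | DropsDown X Y A B e.1 e.2 ∨ GrowsUp X Y A B e.1 e.2} +
        #{e ∈ B ×ˢ A | DropsDown X Y B A e.1 e.2 ∨ GrowsUp X Y B A e.1 e.2} := by
      rw [← card_map (Equiv.prodComm α α).toEmbedding
        (s := {e ∈ B ×ˢ A | DropsDown X Y B A e.1 e.2 ∨ GrowsUp X Y B A e.1 e.2})]
      refine le_trans (card_le_card fun e he => ?_) ((card_union_le _ _).trans
        (add_le_add_left (card_union_le _ _) _))
      have heAB := hE he
      rw [mem_product] at heAB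
      by_contra hn
      simp only [mem_union, not_or, E', mem_filter, he, true_and, mem_product, heAB.1, heAB.2,
        and_self, mem_map_equiv, Equiv.prodComm_symm, Equiv.prodComm_apply, Prod.fst_swap,
        Prod.snd_swap] at hn
      exact hn.1.1 ⟨hn.1.2.1, hn.1.2.2, hn.2.1, hn.2.2⟩
    omega
  have hmem : ∀ e ∈ E', e.1 ∈ A ∧ e.2 ∈ B ∧ StableEdge X Y A B e.1 e.2 := by
    intro e he
    rw [mem_filter] at he
    have := hE he.1
    rw [mem_product] at this
    exact ⟨this.1, this.2, he.2⟩
  have hmaps : ∀ e ∈ E', (level X Y A e.1 e.2 : ℤ) - level X Y B e.1 e.2 ∈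
      Ico (-s : ℤ) s := by
    intro e he
    obtain ⟨h1, h2, -⟩ := hmem e he
    have h3 := h.level_lt_card (Y := Y) h1 h2
    have h4 := h.symm.level_lt_card (Y := Y) h2 h1
    rw [level_comm (h.ne h1 h2).symm] at h4
    rw [mem_Ico]
    omega
  -- Both levels are less than s, so their difference takes at most 2s values.
  obtain ⟨t, -, ht⟩ := exists_le_card_fiber_of_nsmul_le_card_of_maps_to
    (b := (#E' : ℝ) / (2 * s)) hmaps ⟨0, by simp [hs]⟩ (by
      rw [Int.card_Ico, nsmul_eq_mul, show ((s : ℤ) - -s).toNat = 2 * s by omega]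
      push_cast
      have : (0 : ℝ) < s := by exact_mod_cast hs
      exact (mul_div_cancel₀ _ (by positivity)).le)
  refine ⟨{e ∈ E' | (level X Y A e.1 e.2 : ℤ) - level X Y B e.1 e.2 = t},
    (filter_subset _ _).trans (filter_subset _ _), ?_, ?_⟩
  · intro e he f hf hef
    rw [mem_filter] at he hf
    obtain ⟨ha, hb, hst⟩ := hmem e he.1
    obtain ⟨ha', hb', hst'⟩ := hmem f hf.1
    have he2 := he.2
    have hf2 := hf.2
    rcases lt_trichotomy (level X Y B e.1 e.2) (level X Y B f.1 f.2) with hl | hl | hl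
    · exact Or.inl (h.liesBelow hg ha ha' hb hb' hl (by omega) hst hst')
    · have := h.eq_of_levels_eq hg ha ha' hb hb' hl (by omega)
      exact absurd (Prod.ext this.1 this.2) hef
    · exact Or.inr (h.liesBelow hg ha' ha hb' hb hl (by omega) hst' hst)
  · have hs' : (0 : ℝ) < 2 * s := by positivity
    have h1 := (div_le_iff₀' hs').1 ht
    have h2 : (#E : ℝ) ≤ #E' + 2 * NA + 2 * NB := by exact_mod_cast hcard
    linarith

end Edges

/-! ### Partitions with few split cells -/

section Partition

variable {α : Type*} {X Y : α → ℝ}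

theorem card_filter_finRank_lt {S : Finset α} {τ : α → ℝ} (hτ : Set.InjOn τ S) {k : ℕ}
    (hk : k ≤ #S) : #{v ∈ S | finRank S τ v < k} = k := by
  classical
  rw [← card_image_of_injOn ((finRank_injOn hτ).mono (coe_subset.2 (filter_subset _ _)))]
  conv_rhs => rw [← card_range k]
  congr 1
  ext j
  simp only [mem_image, mem_filter, mem_range]
  constructor
  · rintro ⟨v, hv, rfl⟩
    exact hv.2
  · intro hj
    obtain ⟨v, hv, rfl⟩ := exists_finRank_eq hτ (hj.trans_le hk)
    exact ⟨v, ⟨hv, hj⟩, rfl⟩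

/-- Two lines divide a point set into four parts of at most a quarter of the size, such that
every nonvertical line fails to split one of the parts. -/
theorem GenericCoords.exists_four_parts (hg : GenericCoords X Y) (V : Finset α) {K : ℕ}
    (hV : #V ≤ 4 * K) : ∃ Q : Fin 4 → Finset α, (∀ i, Q i ⊆ V ∧ #(Q i) ≤ K) ∧
      (∀ v ∈ V, ∃ i, v ∈ Q i) ∧
      ∀ m k : ℝ, ∃ i, ¬ Splits X Y (Q i) fun x => m * x + k := by
  classical
  rcases Nat.lt_or_ge #V 2 with h2 | h2
  · refine ⟨fun i => if i = 0 then V else ∅, fun i => ?_, fun v hv => ⟨0, by simpa using hv⟩,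
      fun m k => ⟨1, by simp [Splits]⟩⟩
    dsimp only
    split_ifs
    · exact ⟨Subset.rfl, by omega⟩
    · simp
  have hX : Set.InjOn X V := hg.inj.injOn
  set L := {v ∈ V | finRank V X v < #V / 2} with hL
  set R := {v ∈ V | ¬ finRank V X v < #V / 2} with hR
  have hLc : #L = #V / 2 := card_filter_finRank_lt hX (Nat.div_le_self _ _)
  have hLR : #L + #R = #V := card_filter_add_card_filter_not _
  have hsep : SeparatedBy X 1 L R := by
    intro a ha b hb
    rw [mem_filter] at ha hb
    have := (finRank_lt_iff X ha.1).1 (ha.2.trans_le (not_lt.1 hb.2))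
    linarith
  -- A line that halves the left and right halves of V simultaneously.
  obtain ⟨a, ha, b, hb, hla, hlb⟩ := hsep.exists_levels_eq hg (i := #L / 2) (j := #R / 2)
    (by omega) (by omega)
  set g := lineAt X Y a b with hgdef
  have hL2 : #{v ∈ L | Y v < g (X v)} + #{v ∈ L | ¬ Y v < g (X v)} = #L :=
    card_filter_add_card_filter_not _
  have hR2 : #{v ∈ R | Y v < g (X v)} + #{v ∈ R | ¬ Y v < g (X v)} = #R :=
    card_filter_add_card_filter_not _
  have hla' : #{v ∈ L | Y v < g (X v)} = #L / 2 := hla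
  have hlb' : #{v ∈ R | Y v < g (X v)} = #R / 2 := hlb
  have hLV : L ⊆ V := filter_subset _ _
  have hRV : R ⊆ V := filter_subset _ _
  refine ⟨![{v ∈ L | Y v < g (X v)}, {v ∈ L | ¬ Y v < g (X v)}, {v ∈ R | Y v < g (X v)},
    {v ∈ R | ¬ Y v < g (X v)}], ?_, ?_, ?_⟩
  · intro i
    fin_cases i
    · exact ⟨(filter_subset _ _).trans hLV, show #{v ∈ L | Y v < g (X v)} ≤ K by omega⟩
    · exact ⟨(filter_subset _ _).trans hLV, show #{v ∈ L | ¬ Y v < g (X v)} ≤ K by omega⟩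
    · exact ⟨(filter_subset _ _).trans hRV, show #{v ∈ R | Y v < g (X v)} ≤ K by omega⟩
    · exact ⟨(filter_subset _ _).trans hRV, show #{v ∈ R | ¬ Y v < g (X v)} ≤ K by omega⟩
  · intro v hv
    by_cases h1 : finRank V X v < #V / 2 <;> by_cases h2 : Y v < g (X v)
    · exact ⟨0, mem_filter.2 ⟨mem_filter.2 ⟨hv, h1⟩, h2⟩⟩
    · exact ⟨1, mem_filter.2 ⟨mem_filter.2 ⟨hv, h1⟩, h2⟩⟩
    · exact ⟨2, mem_filter.2 ⟨mem_filter.2 ⟨hv, h1⟩, h2⟩⟩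
    · exact ⟨3, mem_filter.2 ⟨mem_filter.2 ⟨hv, h1⟩, h2⟩⟩
  · intro m k
    by_contra hn
    have hall := fun i => not_not.1 (not_exists.1 hn i)
    obtain ⟨-, l1, hl1, hl1'⟩ : Splits X Y {v ∈ L | Y v < g (X v)} fun x => m * x + k := hall 0
    obtain ⟨⟨l2, hl2, hl2'⟩, -⟩ : Splits X Y {v ∈ L | ¬ Y v < g (X v)} fun x => m * x + k :=
      hall 1
    obtain ⟨-, r1, hr1, hr1'⟩ : Splits X Y {v ∈ R | Y v < g (X v)} fun x => m * x + k := hall 2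
    obtain ⟨⟨r2, hr2, hr2'⟩, -⟩ : Splits X Y {v ∈ R | ¬ Y v < g (X v)} fun x => m * x + k :=
      hall 3
    -- Splitting all four parts would force the difference of the two lines to increase from l1 to
    -- r2 and to decrease from l2 to r1.
    rw [mem_filter, hgdef, lineAt_eq] at hl1 hl2 hr1 hr2
    have h1 := hsep l1 hl1.1 r2 hr2.1
    have h2 := hsep l2 hl2.1 r1 hr1.1
    rcases le_total (m - slopeOf X Y a b) 0 with h | h
    · have := mul_nonneg (neg_nonneg.2 h) (show 0 ≤ X r2 - X l1 by linarith)
      linarith [hl1.2, hr2.2]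
    · have := mul_nonneg h (show 0 ≤ X r1 - X l2 by linarith)
      linarith [hl2.2, hr1.2]

open Classical in
/-- A partition into `4 ^ m` parts of equal size, of which every nonvertical line splits at most
`3 ^ m`. -/
theorem GenericCoords.exists_partition (hg : GenericCoords X Y) (s m : ℕ) (V : Finset α)
    (hV : #V ≤ 4 ^ m * s) : ∃ P : Finset (Finset α), #P ≤ 4 ^ m ∧ (∀ S ∈ P, S ⊆ V ∧ #S ≤ s) ∧
      (∀ v ∈ V, ∃ S ∈ P, v ∈ S) ∧
      ∀ μ k : ℝ, #{S ∈ P | Splits X Y S fun x => μ * x + k} ≤ 3 ^ m := by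
  induction m generalizing V with
  | zero =>
    refine ⟨{V}, by simp, by simpa using hV, fun v hv => ⟨V, by simp, hv⟩, fun μ k => ?_⟩
    exact (card_filter_le _ _).trans (by simp)
  | succ m ih =>
    obtain ⟨Q, hQ, hcov, hsplit⟩ := hg.exists_four_parts V (K := 4 ^ m * s)
      (hV.trans (by rw [pow_succ]; exact (by ring_nf; rfl)))
    choose P hPc hPs hPcov hPl using fun i => ih (Q i) (hQ i).2
    refine ⟨univ.biUnion P, ?_, ?_, ?_, ?_⟩
    · refine card_biUnion_le.trans ((sum_le_sum fun i _ => hPc i).trans ?_)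
      simp [pow_succ, mul_comm]
    · intro S hS
      obtain ⟨i, -, hi⟩ := mem_biUnion.1 hS
      exact ⟨(hPs i S hi).1.trans (hQ i).1, (hPs i S hi).2⟩
    · intro v hv
      obtain ⟨i, hi⟩ := hcov v hv
      obtain ⟨S, hS, hvS⟩ := hPcov i v hi
      exact ⟨S, mem_biUnion.2 ⟨i, mem_univ _, hS⟩, hvS⟩
    · intro μ k
      obtain ⟨i, hi⟩ := hsplit μ k
      rw [filter_biUnion]
      refine card_biUnion_le.trans ?_
      -- The quarter that is not split contributes no split cell, so only three of the four
      -- recursive bounds add up.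
      have h0 : #{S ∈ P i | Splits X Y S fun x => μ * x + k} = 0 := by
        rw [card_eq_zero, filter_eq_empty_iff]
        rintro S hS ⟨⟨d, hd, hd'⟩, e, he, he'⟩
        exact hi ⟨⟨d, (hPs i S hS).1 hd, hd'⟩, e, (hPs i S hS).1 he, he'⟩
      rw [← sum_erase_add _ _ (mem_univ i), h0, add_zero]
      refine (sum_le_card_nsmul _ _ (3 ^ m) fun j _ => hPl j μ k).trans ?_
      simp [card_erase_of_mem, pow_succ, mul_comm]

-- Double counting: each pair of points in a cell of `P` spans one line, which splits at most t
-- cells of `Q`.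
open Classical in
theorem sum_splits_le (P Q : Finset (Finset α)) {N s t : ℕ} (hP : #P ≤ N)
    (hPs : ∀ S ∈ P, #S ≤ s)
    (hQ : ∀ μ k : ℝ, #{S ∈ Q | Splits X Y S fun x => μ * x + k} ≤ t) :
    ∑ S ∈ P, ∑ T ∈ Q, #{e ∈ S ×ˢ S | Splits X Y T (lineAt X Y e.1 e.2)} ≤ N * (s * s * t) := by
  have h1 : ∀ S ∈ P, ∑ T ∈ Q, #{e ∈ S ×ˢ S | Splits X Y T (lineAt X Y e.1 e.2)}
      ≤ s * s * t := by
    intro S hS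
    simp_rw [card_filter]
    rw [sum_comm]
    refine (sum_le_card_nsmul _ _ t fun e _ => ?_).trans ?_
    · rw [← card_filter]
      have := hQ (slopeOf X Y e.1 e.2) (Y e.1 - slopeOf X Y e.1 e.2 * X e.1)
      simp_rw [← lineAt_eq] at this
      exact this
    · rw [card_product, smul_eq_mul]
      exact Nat.mul_le_mul_right _ (Nat.mul_le_mul (hPs S hS) (hPs S hS))
  refine (sum_le_card_nsmul _ _ _ h1).trans ?_
  rw [smul_eq_mul]
  exact Nat.mul_le_mul_right _ hP

theorem SeparatedBy.exists_avoiding_of_dense {σ : ℝ} {A B : Finset α} (h : SeparatedBy X σ A B)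
    (hg : GenericCoords X Y) {s m : ℕ} (hs : 0 < s) (hA : #A ≤ 4 ^ m * s) (hB : #B ≤ 4 ^ m * s)
    (E : Finset (α × α)) (hE : E ⊆ A ×ˢ B) :
    ∃ F ⊆ E, (∀ e ∈ F, ∀ f ∈ F, e ≠ f → LiesBelow X Y e f ∨ LiesBelow X Y f e) ∧
      (#E : ℝ) - 4 * 12 ^ m * s ^ 2 ≤ 16 ^ m * (2 * s * #F) := by
  classical
  rcases le_or_gt ((#E : ℝ) - 4 * 12 ^ m * s ^ 2) 0 with hneg | hpos
  · exact ⟨∅, by simp, by simp, by simpa using hneg⟩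
  obtain ⟨P, hPc, hPs, hPcov, hPl⟩ := hg.exists_partition s m A hA
  obtain ⟨Q, hQc, hQs, hQcov, hQl⟩ := hg.exists_partition s m B hB
  let EE : Finset α → Finset α → Finset (α × α) := fun S T => {e ∈ E | e.1 ∈ S ∧ e.2 ∈ T}
  have hsumE : #E ≤ ∑ S ∈ P, ∑ T ∈ Q, #(EE S T) := by
    have : E ⊆ P.biUnion fun S => Q.biUnion fun T => EE S T := by
      intro e he
      have heAB := mem_product.1 (hE he)
      obtain ⟨S, hS, hS'⟩ := hPcov _ heAB.1
      obtain ⟨T, hT, hT'⟩ := hQcov _ heAB.2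
      exact mem_biUnion.2 ⟨S, hS, mem_biUnion.2 ⟨T, hT, mem_filter.2 ⟨he, hS', hT'⟩⟩⟩
    exact (card_le_card this).trans (card_biUnion_le.trans (sum_le_sum fun S _ => card_biUnion_le))
  have hsum1 := sum_splits_le P Q hPc (fun S hS => (hPs S hS).2) hQl
  have hsum2 := sum_splits_le Q P hQc (fun S hS => (hQs S hS).2) hPl
  rw [sum_comm] at hsum2
  let N₁ : Finset α → Finset α → ℕ := fun S T =>
    #{e ∈ S ×ˢ S | Splits X Y T (lineAt X Y e.1 e.2)}
  let w : Finset α × Finset α → ℝ := fun ST =>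
    (#(EE ST.1 ST.2) : ℝ) - 2 * N₁ ST.1 ST.2 - 2 * N₁ ST.2 ST.1
  have hw : (#E : ℝ) - 4 * 12 ^ m * s ^ 2 ≤ ∑ ST ∈ P ×ˢ Q, w ST := by
    rw [sum_product]
    simp only [w, sum_sub_distrib, ← mul_sum]
    have e1 : (#E : ℝ) ≤ ∑ S ∈ P, ∑ T ∈ Q, (#(EE S T) : ℝ) := by exact_mod_cast hsumE
    have e2 : ∑ S ∈ P, ∑ T ∈ Q, (N₁ S T : ℝ) ≤ 4 ^ m * (s * s * 3 ^ m) := by exact_mod_cast hsum1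
    have e3 : ∑ S ∈ P, ∑ T ∈ Q, (N₁ T S : ℝ) ≤ 4 ^ m * (s * s * 3 ^ m) := by exact_mod_cast hsum2
    have e4 : (12 : ℝ) ^ m = 4 ^ m * 3 ^ m := by rw [← mul_pow]; norm_num
    rw [e4]
    nlinarith
  -- There are at most 16^m pairs of cells, so one of them has at least the average weight.
  have hex : ∃ ST ∈ P ×ˢ Q, (#E : ℝ) - 4 * 12 ^ m * s ^ 2 ≤ 16 ^ m * w ST := by
    by_contra! hlt
    have hbound : ∑ ST ∈ P ×ˢ Q, 16 ^ m * w ST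
        ≤ #(P ×ˢ Q) • ((#E : ℝ) - 4 * 12 ^ m * s ^ 2) :=
      sum_le_card_nsmul _ _ _ fun ST hST => (hlt ST hST).le
    have hcardle : (#(P ×ˢ Q) : ℝ) ≤ 16 ^ m := by
      rw [card_product]
      have : #P * #Q ≤ 4 ^ m * 4 ^ m := Nat.mul_le_mul hPc hQc
      rw [← mul_pow] at this
      exact_mod_cast this
    rcases (P ×ˢ Q).eq_empty_or_nonempty with h0 | hne
    · rw [h0, sum_empty] at hw
      linarith
    · have hstrict := sum_lt_sum_of_nonempty hne hlt
      rw [sum_const, nsmul_eq_mul, ← mul_sum] at hstrict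
      have h16 : (0 : ℝ) < 16 ^ m := by positivity
      nlinarith
  obtain ⟨ST, hST, hle⟩ := hex
  rw [mem_product] at hST
  have hsep : SeparatedBy X σ ST.1 ST.2 := fun a ha b hb =>
    h a ((hPs _ hST.1).1 ha) b ((hQs _ hST.2).1 hb)
  obtain ⟨F, hF, hFp, hFc⟩ := hsep.exists_avoiding hg hs (hPs _ hST.1).2 (hQs _ hST.2).2
    (EE ST.1 ST.2) (fun e he => mem_product.2 (mem_filter.1 he).2)
  refine ⟨F, hF.trans (filter_subset _ _), hFp, hle.trans ?_⟩
  exact mul_le_mul_of_nonneg_left hFc (by positivity)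

theorem sum_card_filter_eq [Fintype α] (p : α → α → Prop) [∀ u v, Decidable (p u v)] :
    ∑ u, #{v | p u v} = #{e : α × α | p e.1 e.2} := by
  simp only [card_filter, Fintype.sum_prod_type]

/-! ### A dense cut and the choice of parameters -/

/-- In every geometric graph some vertical line crosses many edges. -/
theorem exists_dense_cut [Fintype α] [Nonempty α] (X : α → ℝ) (E : Finset (α × α))
    (hE : ∀ e ∈ E, X e.1 < X e.2) :
    ∃ v, #E ^ 2 ≤ 2 * Fintype.card α ^ 2 * #{e ∈ E | X e.1 < X v ∧ X v ≤ X e.2} := by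
  classical
  let N : α → Finset α := fun u => {w | (u, w) ∈ E}
  have hNE : ∑ u, #(N u) = #E := by
    simp only [N, card_filter]
    rw [← Fintype.sum_prod_type', ← card_filter]
    congr 1
    ext e
    simp
  -- Of two right neighbours v, w of u with v not beyond w, the edge uw crosses the vertical line at
  -- v; this accounts for at least half of the ordered pairs. Cauchy–Schwarz then bounds the sum of
  -- squared degrees from below.
  have hu : ∀ u, #(N u) ^ 2 ≤
      2 * ∑ v, #{w | (u, w) ∈ E ∧ X u < X v ∧ X v ≤ X w} := by
    intro u
    have h1 : #(N u ×ˢ N u) ≤ #{p ∈ N u ×ˢ N u | X p.1 ≤ X p.2}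
        + #{p ∈ N u ×ˢ N u | X p.2 ≤ X p.1} := by
      refine (card_le_card fun p hp => ?_).trans (card_union_le _ _)
      rcases le_total (X p.1) (X p.2) with h | h <;> simp [mem_product.1 hp, h]
    have h2 : #{p ∈ N u ×ˢ N u | X p.2 ≤ X p.1} = #{p ∈ N u ×ˢ N u | X p.1 ≤ X p.2} := by
      refine card_bij (fun p _ => p.swap) ?_ ?_ ?_
      · intro p hp
        simp only [mem_filter, mem_product] at hp ⊢
        exact ⟨⟨hp.1.2, hp.1.1⟩, hp.2⟩
      · intro p _ q _ h
        exact Prod.swap_injective h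
      · intro p hp
        simp only [mem_filter, mem_product] at hp
        exact ⟨p.swap, by simp [hp.1.1, hp.1.2, hp.2], by simp⟩
    have h3 : #{p ∈ N u ×ˢ N u | X p.1 ≤ X p.2} ≤
        ∑ v, #{w | (u, w) ∈ E ∧ X u < X v ∧ X v ≤ X w} := by
      rw [sum_card_filter_eq fun v w => (u, w) ∈ E ∧ X u < X v ∧ X v ≤ X w]
      refine card_le_card fun p hp => ?_
      simp only [N, mem_filter, mem_product, mem_univ, true_and] at hp ⊢
      exact ⟨hp.1.2, hE _ hp.1.1, hp.2⟩
    rw [card_product] at h1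
    nlinarith
  have hcs : #E ^ 2 ≤ Fintype.card α * ∑ u, #(N u) ^ 2 := by
    rw [← hNE]
    exact sq_sum_le_card_mul_sum_sq
  have htot : ∑ u, #(N u) ^ 2 ≤ 2 * ∑ v, #{e ∈ E | X e.1 < X v ∧ X v ≤ X e.2} := by
    refine (sum_le_sum fun u _ => hu u).trans ?_
    rw [← mul_sum, sum_comm]
    refine Nat.mul_le_mul_left _ (sum_le_sum fun v _ => ?_)
    rw [sum_card_filter_eq fun u w => (u, w) ∈ E ∧ X u < X v ∧ X v ≤ X w]
    refine card_le_card fun p hp => ?_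
    simpa using hp
  by_contra! hlt
  have hs := sum_lt_sum_of_nonempty (univ_nonempty (α := α)) fun v _ => hlt v
  rw [sum_const, smul_eq_mul, card_univ, ← mul_sum] at hs
  have hn : 0 < Fintype.card α := Fintype.card_pos
  have : #E ^ 2 ≤ 2 * Fintype.card α * ∑ v, #{e ∈ E | X e.1 < X v ∧ X v ≤ X e.2} :=
    hcs.trans (by nlinarith)
  nlinarith

/-- A geometric graph with `n` vertices and `e` edges has at least a constant times
`(e / n ^ 2) ^ 12 * n` pairwise avoiding edges. -/
theorem GenericCoords.exists_avoiding [Fintype α] (hg : GenericCoords X Y)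
    (E : Finset (α × α)) (hE : ∀ e ∈ E, X e.1 < X e.2) (hne : E.Nonempty) :
    ∃ F ⊆ E, (∀ e ∈ F, ∀ f ∈ F, e ≠ f → LiesBelow X Y e f ∨ LiesBelow X Y f e) ∧
      ((#E : ℝ) / (Fintype.card α : ℝ) ^ 2) ^ 12 * Fintype.card α / 2 ^ 36 ≤ #F := by
  classical
  obtain ⟨e₀, he₀⟩ := hne
  have : Nonempty α := ⟨e₀.1⟩
  obtain ⟨v, hv⟩ := exists_dense_cut X E hE
  set n := Fintype.card α with hn
  have hn0 : (0 : ℝ) < n := by exact_mod_cast Fintype.card_pos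
  set δ : ℝ := #E / (n : ℝ) ^ 2 with hδ
  have hE0 : (0 : ℝ) < #E := by exact_mod_cast card_pos.2 ⟨e₀, he₀⟩
  have hδ0 : 0 < δ := by positivity
  have hδ1 : δ ≤ 1 := by
    rw [hδ, div_le_one (by positivity)]
    have : #E ≤ n * n := by
      rw [hn, ← Fintype.card_prod]; exact card_le_univ E
    rw [sq]
    exact_mod_cast this
  set β : ℝ := δ ^ 2 / 2 with hβ
  have hβ0 : 0 < β := by positivity
  have hβ1 : β ≤ 1 := by
    rw [hβ]; nlinarith
  have hδβ : δ ^ 12 * n / 2 ^ 36 = β ^ 6 * n / 2 ^ 30 := by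
    rw [hβ]; ring
  rw [hδβ]
  set E₀ := {e ∈ E | X e.1 < X v ∧ X v ≤ X e.2} with hE₀
  have hcut : β * (n : ℝ) ^ 2 ≤ #E₀ := by
    have h1 : (#E : ℝ) ^ 2 ≤ 2 * (n : ℝ) ^ 2 * #E₀ := by exact_mod_cast hv
    have h2 : (#E : ℝ) = δ * (n : ℝ) ^ 2 := by rw [hδ]; field_simp
    rw [h2] at h1
    have hn2 : (0 : ℝ) < (n : ℝ) ^ 2 := by positivity
    have h3 : (n : ℝ) ^ 2 * (β * (n : ℝ) ^ 2) ≤ (n : ℝ) ^ 2 * #E₀ := by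
      rw [hβ]; nlinarith
    exact le_of_mul_le_mul_left h3 hn2
  -- The exponent m + 1 is the first at which (3/4)^(m+1) drops to β/32, so that split pairs cost at
  -- most half of the crossing edges. The fifth power below comes from 4 ≤ (4/3)^5.
  obtain ⟨m, hm1, hm2⟩ := exists_nat_pow_near (x := 32 / β) (y := (4 / 3 : ℝ))
    ((one_le_div hβ0).2 (by linarith)) (by norm_num)
  have h4 : (4 : ℝ) ^ (m + 1) ≤ 2 ^ 27 / β ^ 5 := by
    have h5 : (4 : ℝ) ^ m ≤ ((4 / 3 : ℝ) ^ m) ^ 5 := by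
      rw [← pow_mul, mul_comm, pow_mul]
      exact pow_le_pow_left₀ (by norm_num) (by norm_num) _
    have h6 : ((4 / 3 : ℝ) ^ m) ^ 5 ≤ (32 / β) ^ 5 := pow_le_pow_left₀ (by positivity) hm1 _
    calc (4 : ℝ) ^ (m + 1) = 4 ^ m * 4 := pow_succ _ _
      _ ≤ (32 / β) ^ 5 * 4 := by linarith
      _ = 2 ^ 27 / β ^ 5 := by rw [div_pow]; ring
  have h34 : (3 / 4 : ℝ) ^ (m + 1) ≤ β / 32 := by
    have e : (3 / 4 : ℝ) ^ (m + 1) = ((4 / 3 : ℝ) ^ (m + 1))⁻¹ := by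
      rw [← inv_pow]; norm_num
    have e' : β / 32 = (32 / β)⁻¹ := (inv_div _ _).symm
    rw [e, e']
    exact inv_anti₀ (by positivity) hm2.le
  generalize m + 1 = M at h4 h34
  have hβ5 : (0 : ℝ) < β ^ 5 := by positivity
  rw [le_div_iff₀ hβ5] at h4
  rcases le_or_gt (4 ^ M) n with hMn | hMn
  · have hM0 : 0 < 4 ^ M := by positivity
    set s := n / 4 ^ M + 1 with hs
    have hns : n ≤ 4 ^ M * s := by
      rw [hs]
      exact (Nat.lt_mul_div_succ n hM0).le
    have hs2 : 4 ^ M * s ≤ 2 * n := by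
      have := Nat.mul_div_le n (4 ^ M)
      rw [hs, mul_add]
      linarith
    have hsep : SeparatedBy X 1 {u | X u < X v} {u | X v ≤ X u} := by
      intro a ha b hb
      simp only [mem_filter, mem_univ, true_and] at ha hb
      linarith
    obtain ⟨F, hF, hFp, hFc⟩ := hsep.exists_avoiding_of_dense hg (s := s) (m := M) (Nat.succ_pos _)
      ((card_le_univ _).trans hns) ((card_le_univ _).trans hns) E₀ (fun e he => by
        rw [mem_filter] at he
        simp [he.2.1, he.2.2])
    refine ⟨F, hF.trans (filter_subset _ _), hFp, ?_⟩
    have hs2' : (4 : ℝ) ^ M * s ≤ 2 * n := by exact_mod_cast hs2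
    have e12 : (4 : ℝ) * 12 ^ M * s ^ 2 = 4 * (3 / 4) ^ M * (4 ^ M * s) ^ 2 := by
      have : (12 : ℝ) ^ M = (3 / 4) ^ M * 4 ^ M * 4 ^ M := by
        rw [← mul_pow, ← mul_pow]; norm_num
      rw [this]; ring
    have h1 : (4 : ℝ) * 12 ^ M * s ^ 2 ≤ β * n ^ 2 / 2 := by
      rw [e12]
      have : ((4 : ℝ) ^ M * s) ^ 2 ≤ (2 * n) ^ 2 := pow_le_pow_left₀ (by positivity) hs2' _
      calc 4 * (3 / 4 : ℝ) ^ M * (4 ^ M * s) ^ 2 ≤ 4 * (β / 32) * (2 * n) ^ 2 := by gcongr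
        _ = β * n ^ 2 / 2 := by ring
    have h2 : (16 : ℝ) ^ M * (2 * s * #F) ≤ 4 ^ M * (4 * n * #F) := by
      have : (16 : ℝ) ^ M = 4 ^ M * 4 ^ M := by rw [← mul_pow]; norm_num
      rw [this]
      calc (4 : ℝ) ^ M * 4 ^ M * (2 * s * #F) = 4 ^ M * (2 * (4 ^ M * s) * #F) := by ring
        _ ≤ 4 ^ M * (2 * (2 * n) * #F) := by gcongr
        _ = 4 ^ M * (4 * n * #F) := by ring
    have h3 : β * (n : ℝ) ^ 2 ≤ 8 * 4 ^ M * n * #F := by linarith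
    have h5 : β * (n : ℝ) ≤ 8 * 4 ^ M * #F := by
      refine le_of_mul_le_mul_left ?_ hn0
      linarith
    rw [div_le_iff₀ (by positivity)]
    calc β ^ 6 * n = β ^ 5 * (β * n) := by ring
      _ ≤ β ^ 5 * (8 * 4 ^ M * #F) := by gcongr
      _ = 8 * (4 ^ M * β ^ 5) * #F := by ring
      _ ≤ 8 * 2 ^ 27 * #F := by gcongr
      _ = #F * 2 ^ 30 := by ring
  -- With fewer points than cells the claimed bound is at most 1, so a single edge suffices.
  · refine ⟨{e₀}, by simpa using he₀, ?_, ?_⟩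
    · intro e he f hf hef
      rw [mem_singleton] at he hf
      exact absurd (he.trans hf.symm) hef
    · rw [card_singleton, Nat.cast_one, div_le_one (by positivity)]
      have hMn' : (n : ℝ) ≤ 4 ^ M := by exact_mod_cast hMn.le
      calc β ^ 6 * n = β * (n * β ^ 5) := by ring
        _ ≤ 1 * (4 ^ M * β ^ 5) := by gcongr
        _ ≤ 2 ^ 30 := by linarith

end Partition

/-! ### Return to the Euclidean plane -/

/-- The affine form y - m(x + ty) - k vanishes on the line pq and, after multiplication by the sign
c, is positive at r and s, hence on the whole segment. -/
theorem disjoint_convexHull_affineSpan {p q r s : Plane} (m k t c : ℝ)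
    (hp : p 1 = m * (p 0 + t * p 1) + k) (hq : q 1 = m * (q 0 + t * q 1) + k)
    (hr : 0 < c * (r 1 - (m * (r 0 + t * r 1) + k)))
    (hs : 0 < c * (s 1 - (m * (s 0 + t * s 1) + k))) :
    Disjoint (convexHull ℝ {r, s}) (affineSpan ℝ ({p, q} : Set Plane) : Set Plane) := by
  rw [Set.disjoint_left]
  intro z hz hz'
  rw [convexHull_pair] at hz
  obtain ⟨a, b, ha, hb, hab, rfl⟩ := hz
  obtain ⟨u, hu⟩ := mem_affineSpan_pair_iff_exists_lineMap_eq.1 hz'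
  have h0 := congrArg (fun w : Plane => w 0) hu
  have h1 := congrArg (fun w : Plane => w 1) hu
  simp only [AffineMap.lineMap_apply, vsub_eq_sub, vadd_eq_add, PiLp.add_apply, PiLp.smul_apply,
    PiLp.sub_apply, smul_eq_mul] at h0 h1
  have hpos : 0 < a * (c * (r 1 - (m * (r 0 + t * r 1) + k)))
      + b * (c * (s 1 - (m * (s 0 + t * s 1) + k))) := by
    rcases ha.eq_or_lt with rfl | ha
    · rw [zero_add] at hab
      subst hab
      linarith
    · have := mul_pos ha hr
      have := mul_nonneg hb hs.le
      linarith
  have hz0 : (a * r 1 + b * s 1) - (m * ((a * r 0 + b * s 0) + t * (a * r 1 + b * s 1)) + k)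
      = 0 := by
    rw [← h0, ← h1]
    linear_combination (1 - u) * hp + u * hq
  have hb' : b = 1 - a := by linarith
  subst hb'
  have : a * (c * (r 1 - (m * (r 0 + t * r 1) + k)))
      + (1 - a) * (c * (s 1 - (m * (s 0 + t * s 1) + k))) = 0 := by
    linear_combination c * hz0
  linarith

theorem edgeEndpoints_mk {V : Finset Plane} (p q : V) :
    edgeEndpoints s(p, q) = {(p : Plane), (q : Plane)} := by
  ext z
  simp only [edgeEndpoints, Sym2.mem_iff, Set.mem_ofPred_eq, Set.mem_insert_iff,
    Set.mem_singleton_iff]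
  constructor
  · rintro ⟨v, rfl | rfl, rfl⟩ <;> simp
  · rintro (rfl | rfl)
    · exact ⟨p, Or.inl rfl, rfl⟩
    · exact ⟨q, Or.inr rfl, rfl⟩

/-- The abscissa of a point after a shear of the plane. -/
noncomputable def shearX (V : Finset Plane) (t : ℝ) (p : V) : ℝ := p.1 0 + t * p.1 1

/-- The ordinate of a point. -/
noncomputable def ordinate (V : Finset Plane) (p : V) : ℝ := p.1 1

theorem exists_shearX_injective (V : Finset Plane) :
    ∃ t, Function.Injective (shearX V t) := by
  classical
  -- Each pair of points at different heights excludes one shear; a pair at equal heights is never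
  -- merged.
  obtain ⟨t, ht⟩ := Infinite.exists_notMem_finset
    (univ.image fun e : V × V => (e.2.1 0 - e.1.1 0) / (e.1.1 1 - e.2.1 1))
  refine ⟨t, fun p q h => ?_⟩
  by_contra hne
  rw [shearX, shearX] at h
  rcases eq_or_ne (p.1 1) (q.1 1) with h1 | h1
  · refine hne (Subtype.ext (PiLp.ext fun i => ?_))
    fin_cases i
    · rw [h1] at h
      simpa using h
    · exact h1
  · refine ht (mem_image.2 ⟨(p, q), mem_univ _, ?_⟩)
    rw [div_eq_iff (sub_ne_zero.2 h1)]
    linarith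

theorem InGeneralPosition.genericCoords {V : Finset Plane} (hV : InGeneralPosition V) {t : ℝ}
    (ht : Function.Injective (shearX V t)) : GenericCoords (shearX V t) (ordinate V) := by
  refine ⟨ht, fun p q r hpq hpr hqr h => ?_⟩
  refine hV p p.2 q q.2 r r.2 (Subtype.coe_ne_coe.2 hpq) (Subtype.coe_ne_coe.2 hpr)
    (Subtype.coe_ne_coe.2 hqr) ?_
  have hX : shearX V t q - shearX V t p ≠ 0 := sub_ne_zero.2 fun e => hpq (ht e).symm
  set s := (shearX V t r - shearX V t p) / (shearX V t q - shearX V t p) with hs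
  have hY : r.1 1 = p.1 1 + s * (q.1 1 - p.1 1) := by
    have h' : r.1 1 = p.1 1 + (q.1 1 - p.1 1) / (shearX V t q - shearX V t p)
      * (shearX V t r - shearX V t p) := h
    rw [h', hs]
    ring
  have hX' : r.1 0 + t * r.1 1 = p.1 0 + t * p.1 1
      + s * ((q.1 0 + t * q.1 1) - (p.1 0 + t * p.1 1)) := by
    have : s * (shearX V t q - shearX V t p) = shearX V t r - shearX V t p :=
      div_mul_cancel₀ _ hX
    simp only [shearX] at this
    linarith
  rw [collinear_iff_of_mem (p₀ := p.1) (by simp)]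
  refine ⟨q.1 - p.1, ?_⟩
  simp only [Set.mem_insert_iff, Set.mem_singleton_iff, vadd_eq_add, forall_eq_or_imp, forall_eq]
  refine ⟨⟨0, by simp⟩, ⟨1, by simp⟩, s, ?_⟩
  refine PiLp.ext fun i => ?_
  fin_cases i
  · simp only [Fin.zero_eta, PiLp.add_apply, PiLp.smul_apply, PiLp.sub_apply, smul_eq_mul]
    rw [hY] at hX'
    linear_combination hX'
  · simp only [Fin.mk_one, PiLp.add_apply, PiLp.smul_apply, PiLp.sub_apply, smul_eq_mul]
    linear_combination hY

theorem LiesBelow.avoidingEdges {V : Finset Plane} {t : ℝ} {e f : V × V}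
    (he : shearX V t e.1 ≠ shearX V t e.2) (hf : shearX V t f.1 ≠ shearX V t f.2)
    (h : LiesBelow (shearX V t) (ordinate V) e f) :
    AvoidingEdges s(e.1, e.2) s(f.1, f.2) := by
  obtain ⟨⟨h1, h2⟩, h3, h4⟩ := h
  have e1 := lineAt_left (X := shearX V t) (Y := ordinate V) e.1 e.2
  have e2 := lineAt_right (Y := ordinate V) he
  have f1 := lineAt_left (X := shearX V t) (Y := ordinate V) f.1 f.2
  have f2 := lineAt_right (Y := ordinate V) hf
  rw [lineAt_eq] at e1 e2 f1 f2 h1 h2 h3 h4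
  rw [AvoidingEdges, edgeSegment, edgeSegment, edgeLine, edgeLine, edgeEndpoints_mk,
    edgeEndpoints_mk]
  refine ⟨disjoint_convexHull_affineSpan _ _ t (-1) f1.symm f2.symm ?_ ?_,
    disjoint_convexHull_affineSpan _ _ t 1 e1.symm e2.symm ?_ ?_⟩
  · have : (e.1.1 1 : ℝ) < _ := h3
    rw [shearX] at this
    linarith
  · have : (e.2.1 1 : ℝ) < _ := h4
    rw [shearX] at this
    linarith
  · have : _ < (f.1.1 1 : ℝ) := h1
    rw [shearX] at this
    linarith
  · have : _ < (f.2.1 1 : ℝ) := h2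
    rw [shearX] at this
    linarith

theorem AvoidingEdges.symm {V : Finset Plane} {e f : Sym2 V} (h : AvoidingEdges e f) :
    AvoidingEdges f e := And.symm h

theorem HasPairwiseAvoidingEdges.mono {V : Finset Plane} {G : SimpleGraph V} {x y : ℝ}
    (h : HasPairwiseAvoidingEdges G y) (hxy : x ≤ y) : HasPairwiseAvoidingEdges G x := by
  obtain ⟨F, h1, h2, h3⟩ := h
  exact ⟨F, h1, h2, hxy.trans h3⟩

theorem hasPairwiseAvoidingEdges_one {V : Finset Plane} {G : SimpleGraph V}
    (h : 0 < G.edgeSet.ncard) : HasPairwiseAvoidingEdges G 1 := by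
  obtain ⟨e, he⟩ := Set.nonempty_of_ncard_ne_zero h.ne'
  exact ⟨{e}, by simpa using he, by simp, by simp⟩

/-- A geometric graph with `n` vertices and `e > 0` edges has at least `(e / n ^ 2) ^ 12 * n / 2 ^ 36`
pairwise avoiding edges. -/
theorem InGeneralPosition.hasPairwiseAvoidingEdges {V : Finset Plane} (hV : InGeneralPosition V)
    (G : SimpleGraph V) (hG : 0 < G.edgeSet.ncard) :
    HasPairwiseAvoidingEdges G
      (((G.edgeSet.ncard : ℝ) / (#V : ℝ) ^ 2) ^ 12 * #V / 2 ^ 36) := by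
  classical
  obtain ⟨t, ht⟩ := exists_shearX_injective V
  have hg := hV.genericCoords ht
  let E : Finset (V × V) := {e | G.Adj e.1 e.2 ∧ shearX V t e.1 < shearX V t e.2}
  have hE : ∀ e ∈ E, G.Adj e.1 e.2 ∧ shearX V t e.1 < shearX V t e.2 := by simp [E]
  have hcard : G.edgeSet.ncard ≤ #E := by
    refine le_trans ?_ (card_image_le (f := fun e : V × V => s(e.1, e.2)))
    rw [← Set.ncard_coe_finset]
    refine Set.ncard_le_ncard (fun z hz => ?_) (Finset.finite_toSet _)
    induction z using Sym2.ind with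
    | _ p q =>
      rw [SimpleGraph.mem_edgeSet] at hz
      rw [mem_coe, mem_image]
      rcases lt_or_gt_of_ne (fun e => hz.ne (ht e) : shearX V t p ≠ shearX V t q) with h | h
      · exact ⟨(p, q), by simp [E, hz, h], rfl⟩
      · exact ⟨(q, p), by simp [E, hz.symm, h], Sym2.eq_swap⟩
  obtain ⟨F, hFE, hFp, hFc⟩ := hg.exists_avoiding E (fun e he => (hE e he).2)
    (card_pos.1 (hG.trans_le hcard))
  have hlt : ∀ e ∈ F, shearX V t e.1 < shearX V t e.2 := fun e he => (hE e (hFE he)).2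
  refine ⟨F.image fun e : V × V => s(e.1, e.2), ?_, ?_, ?_⟩
  · intro z hz
    obtain ⟨e, he, rfl⟩ := mem_image.1 (mem_coe.1 hz)
    exact (hE e (hFE he)).1
  · intro z hz w hw hzw
    obtain ⟨e, he, rfl⟩ := mem_image.1 (mem_coe.1 hz)
    obtain ⟨f, hf, rfl⟩ := mem_image.1 (mem_coe.1 hw)
    rcases hFp e he f hf (fun h => hzw (by rw [h])) with h | h
    · exact h.avoidingEdges (hlt e he).ne (hlt f hf).ne
    · exact (h.avoidingEdges (hlt f hf).ne (hlt e he).ne).symm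
  · rw [card_image_of_injOn]
    · refine le_trans ?_ hFc
      rw [Fintype.card_coe]
      gcongr
    · intro e he f hf hef
      have h1 := hlt e he
      have h2 := hlt f hf
      rcases Sym2.eq_iff.1 hef with ⟨h, h'⟩ | ⟨h, h'⟩
      · exact Prod.ext h h'
      · rw [h, h'] at h1
        exact absurd h1 h2.not_gt

/-! ### Deduction of the two bounds -/

theorem theorem2 :
    (∃ C : ℝ, 0 < C ∧ ∀ V : Finset Plane, InGeneralPosition V → 2 ≤ V.card →
      HasPairwiseAvoidingEdges (⊤ : SimpleGraph V)
        ((V.card : ℝ) / (2 : ℝ) ^ (C * Real.sqrt (Real.logb 2 (V.card : ℝ))))) ∧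
    (∃ c : ℝ, 0 < c ∧ ∀ V : Finset Plane, InGeneralPosition V → 2 ≤ V.card →
      ∀ (G : SimpleGraph V) (ε : ℝ),
        (Real.logb 2 (V.card : ℝ)) ^ (-(2 / 3 : ℝ)) < ε →
        (V.card : ℝ) ^ (2 - ε) ≤ (G.edgeSet.ncard : ℝ) →
        HasPairwiseAvoidingEdges G ((V.card : ℝ) ^ (1 - c * Real.sqrt ε))) := by
  classical
  have hlog : ∀ n : ℕ, 2 ≤ n → 1 ≤ Real.logb 2 (n : ℝ) := fun n hn => by
    have hn' : (2 : ℝ) ≤ n := by exact_mod_cast hn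
    rw [Real.le_logb_iff_rpow_le (by norm_num) (by linarith)]
    simpa using hn'
  -- 60 = 24 + 36: density at least 1/4 costs 4^12 = 2^24. 48 = 12 + 36: the density n^(-ε) enters
  -- with exponent 12, and 2^36 is absorbed by n^(36√ε).
  refine ⟨⟨60, by norm_num, fun V hV hn => ?_⟩, 48, by norm_num, fun V hV hn G ε hε hG => ?_⟩
  · have hn' : (2 : ℝ) ≤ #V := by exact_mod_cast hn
    have he : ((⊤ : SimpleGraph V).edgeSet.ncard : ℝ) = #V * (#V - 1) / 2 := by
      rw [← SimpleGraph.coe_edgeFinset, Set.ncard_coe_finset,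
        SimpleGraph.card_edgeFinset_top_eq_card_choose_two, Fintype.card_coe,
        Nat.cast_choose_two]
    have he' : (#V : ℝ) ^ 2 / 4 ≤ ((⊤ : SimpleGraph V).edgeSet.ncard : ℝ) := by
      rw [he]; nlinarith
    have hV2 : (0 : ℝ) < (#V : ℝ) ^ 2 := by positivity
    have hpos : 0 < (⊤ : SimpleGraph V).edgeSet.ncard := by
      have : (0 : ℝ) < ((⊤ : SimpleGraph V).edgeSet.ncard : ℝ) := by linarith
      exact_mod_cast this
    refine (hV.hasPairwiseAvoidingEdges _ hpos).mono ?_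
    have h1 : (1 / 4 : ℝ) ≤ ((⊤ : SimpleGraph V).edgeSet.ncard : ℝ) / (#V : ℝ) ^ 2 := by
      rw [le_div_iff₀ hV2]; linarith
    have h2 : (2 : ℝ) ^ 60 ≤ (2 : ℝ) ^ (60 * Real.sqrt (Real.logb 2 (#V : ℝ))) := by
      rw [← Real.rpow_natCast]
      refine Real.rpow_le_rpow_of_exponent_le (by norm_num) ?_
      have := Real.one_le_sqrt.2 (hlog _ hn)
      push_cast
      linarith
    calc (#V : ℝ) / (2 : ℝ) ^ (60 * Real.sqrt (Real.logb 2 (#V : ℝ))) ≤ #V / 2 ^ 60 := by gcongr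
      _ = (1 / 4) ^ 12 * #V / 2 ^ 36 := by ring
      _ ≤ _ := by gcongr
  · have hn' : (2 : ℝ) ≤ #V := by exact_mod_cast hn
    have hn0 : (0 : ℝ) < #V := by linarith
    have hpos : 0 < G.edgeSet.ncard := by
      have : (0 : ℝ) < (G.edgeSet.ncard : ℝ) := (Real.rpow_pos_of_pos hn0 _).trans_le hG
      exact_mod_cast this
    rcases le_or_gt 1 ε with h1 | h1
    · refine (hasPairwiseAvoidingEdges_one hpos).mono ?_
      have := Real.one_le_sqrt.2 h1
      exact Real.rpow_le_one_of_one_le_of_nonpos (by linarith) (by linarith)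
    · refine (hV.hasPairwiseAvoidingEdges G hpos).mono ?_
      set l := Real.logb 2 (#V : ℝ) with hl
      have hl1 : 1 ≤ l := hlog _ hn
      have hε0 : 0 < ε := (Real.rpow_pos_of_pos (by linarith) _).trans hε
      have hεs : ε ≤ √ε := Real.le_sqrt_of_sq_le (by nlinarith)
      -- Only the weaker consequence ε ≥ l^(-2) of the assumption on ε is needed.
      have hls : 1 ≤ l * √ε := by
        have h2 : l ^ (-2 : ℝ) ≤ ε :=
          (Real.rpow_le_rpow_of_exponent_le hl1 (by norm_num)).trans hε.le
        have h3 : (l⁻¹) ^ 2 ≤ ε := by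
          rw [Real.rpow_neg (by linarith), Real.rpow_two, ← inv_pow] at h2
          exact h2
        have h4 := Real.le_sqrt_of_sq_le h3
        calc (1 : ℝ) = l * l⁻¹ := (mul_inv_cancel₀ (by linarith)).symm
          _ ≤ l * √ε := by gcongr
      have hδ : (#V : ℝ) ^ (-ε) ≤ (G.edgeSet.ncard : ℝ) / (#V : ℝ) ^ 2 := by
        rw [le_div_iff₀ (by positivity), ← Real.rpow_two, ← Real.rpow_add hn0]
        rwa [show -ε + 2 = 2 - ε by ring]
      have h36 : (2 : ℝ) ^ 36 ≤ (#V : ℝ) ^ (36 * √ε) := by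
        have : (#V : ℝ) = 2 ^ l := (Real.rpow_logb (by norm_num) (by norm_num) hn0).symm
        rw [this, ← Real.rpow_mul (by norm_num), ← Real.rpow_natCast]
        refine Real.rpow_le_rpow_of_exponent_le (by norm_num) ?_
        push_cast
        linarith
      rw [le_div_iff₀ (by positivity)]
      calc (#V : ℝ) ^ (1 - 48 * √ε) * 2 ^ 36
          ≤ (#V : ℝ) ^ (1 - 48 * √ε) * (#V : ℝ) ^ (36 * √ε) := by gcongr
        _ = (#V : ℝ) ^ (1 - 12 * √ε) := by rw [← Real.rpow_add hn0]; congr 1; ring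
        _ ≤ (#V : ℝ) ^ (-ε * (12 : ℕ) + 1) := by
          refine Real.rpow_le_rpow_of_exponent_le (by linarith) ?_
          push_cast
          linarith
        _ = ((#V : ℝ) ^ (-ε)) ^ 12 * #V := by
          rw [Real.rpow_add hn0, Real.rpow_one, Real.rpow_mul hn0.le, Real.rpow_natCast]
        _ ≤ _ := by gcongr
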